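/- Let $G$ be a locally compact (Hausdorff) group with identity $e$, let $ds$ be a left Haar measure on $G$, and let $L^2(G)$ be the corresponding Hilbert space, with inner product linear in the first variable. Let $\sigma: G\times G\to\mathbb{T}$ be a continuous 2-cocycle, i.e. a continuous function with $$\sigma(s,t)\,\sigma(st,r)=\sigma(s,tr)\,\sigma(t,r),\qquad \sigma(s,e)=\sigma(e,t)=1\qquad (s,t,r\in G).$$ Let $\lambda_\sigma$ be the left regular $\sigma$-representation of $G$ on $L^2(G)$, given by the unitary operators $$(\lambda_\sigma(s)f)(t)=\sigma(s,s^{-1}t)\,f(s^{-1}t)\qquad (s,t\in G,\ f\in L^2(G)).$$ Let $\mathcal{P}_1(G,\sigma)$ be the set of all bounded continuous functions $\varphi: G\to\mathbb{C}$ with $\varphi(e)=1$ that are $\sigma$-positive definite, i.e. such that $$\sum_{s,t\in G}\overline{\sigma(s,s^{-1}t)}\,\varphi(s^{-1}t)\,\overline{\alpha(s)}\,\alpha(t)\ \ge\ 0$$ for every finitely supported function $\alpha: G\to\mathbb{C}$. If $\varphi\in\mathcal{P}_1(G,\sigma)$ has compact support, then there is $\psi\in L^2(G)$ such that $$\varphi(s)=\langle\lambda_\sigma(s)\psi,\psi\rangle\qquad\text{for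 all } s\in G.$$ -/

import Mathlib

open MeasureTheory
open scoped ENNReal ComplexConjugate

/-- A `2`-cocycle on a topological group `G`: a normalised, Borel measurable function
`σ : G × G → 𝕋` with `σ(s,t) σ(st,r) = σ(s,tr) σ(t,r)`. "Borel" refers to the Borel `σ`-algebra
of the product topology on `G × G`. -/
structure TwoCocycle (G : Type*) [Group G] [TopologicalSpace G] where
  toFun : G → G → Circle
  borel_measurable : @Measurable (G × G) Circle (borel (G × G)) (borel Circle)
    (fun p => toFun p.1 p.2)
  cocycle : ∀ s t r : G, toFun s t * toFun (s * t) r = toFun s (t * r) * toFun t r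
  right_one : ∀ s : G, toFun s 1 = 1
  left_one : ∀ t : G, toFun 1 t = 1

namespace TwoCocycle

instance instCoeFun {G : Type*} [Group G] [TopologicalSpace G] :
    CoeFun (TwoCocycle G) (fun _ => G → G → Circle) := ⟨TwoCocycle.toFun⟩

/-- `σ` is a continuous `2`-cocycle: it is jointly continuous on `G × G`. -/
def IsContinuous {G : Type*} [Group G] [TopologicalSpace G] (σ : TwoCocycle G) : Prop :=
  Continuous (fun p : G × G => σ p.1 p.2)

section PositiveDefinite

variable {G : Type*} [Group G] [TopologicalSpace G]

open scoped ComplexOrder in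
/-- `φ : G → ℂ` is `σ`-positive definite: for every finitely supported `α : G → ℂ` the sum
`∑_{s,t} conj σ(s,s⁻¹t) φ(s⁻¹t) conj α(s) α(t)` is real and nonnegative. -/
def IsPositiveDefinite (σ : TwoCocycle G) (φ : G → ℂ) : Prop :=
  ∀ α : G →₀ ℂ, 0 ≤ ∑ s ∈ α.support, ∑ t ∈ α.support,
    conj (σ s (s⁻¹ * t) : ℂ) * φ (s⁻¹ * t) * conj (α s) * α t

/-- `𝒫(G,σ)`: the bounded continuous `σ`-positive definite functions on `G`. -/
def P (σ : TwoCocycle G) : Set (G → ℂ) :=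
  {φ | Continuous φ ∧ (∃ C : ℝ, ∀ s, ‖φ s‖ ≤ C) ∧ σ.IsPositiveDefinite φ}

/-- `𝒫₁(G,σ)`: the elements of `𝒫(G,σ)` with value `1` at the identity. -/
def P₁ (σ : TwoCocycle G) : Set (G → ℂ) :=
  {φ | φ ∈ σ.P ∧ φ 1 = 1}

end PositiveDefinite

/-- The sections `t ↦ σ(s,t)` are Borel measurable. -/
theorem measurable_section {G : Type*} [Group G] [TopologicalSpace G] [MeasurableSpace G]
    [BorelSpace G] (σ : TwoCocycle G) (s : G) : Measurable (fun t : G => (σ s t : ℂ)) := by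
  have h1 : @Measurable G (G × G) (borel G) (borel (G × G)) (fun t : G => (s, t)) :=
    (Continuous.prodMk_right s).borel_measurable
  have h2 : @Measurable Circle ℂ (borel Circle) (borel ℂ) (fun z : Circle => (z : ℂ)) :=
    Continuous.borel_measurable continuous_subtype_val
  have h3 := h2.comp (σ.borel_measurable.comp h1)
  rw [← BorelSpace.measurable_eq (α := G), ← BorelSpace.measurable_eq (α := ℂ)] at h3
  exact h3

section LeftRegular

variable {G : Type*} [Group G] [TopologicalSpace G] [IsTopologicalGroup G]
  [MeasurableSpace G] [BorelSpace G] (σ : TwoCocycle G)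

/-- The pointwise formula `(λ_σ(s) f)(t) = σ(s,s⁻¹t) f(s⁻¹t)`. -/
def leftRegularFun (s : G) (f : G → ℂ) : G → ℂ :=
  fun t => (σ s (s⁻¹ * t) : ℂ) * f (s⁻¹ * t)

/-- The pointwise formula `t ↦ conj σ(s,t) f(st)` for the inverse of `λ_σ(s)`. -/
def leftRegularInvFun (s : G) (f : G → ℂ) : G → ℂ :=
  fun t => conj (σ s t : ℂ) * f (s * t)

variable (μ : Measure G) [μ.IsMulLeftInvariant]

theorem eLpNorm_leftRegularFun (s : G) {f : G → ℂ} (hf : AEStronglyMeasurable f μ) :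
    eLpNorm (σ.leftRegularFun s f) 2 μ = eLpNorm f 2 μ := by
  rw [← eLpNorm_comp_measurePreserving hf (measurePreserving_mul_left μ s⁻¹)]
  exact eLpNorm_congr_norm_ae (Filter.Eventually.of_forall fun t => by simp [leftRegularFun, Circle.norm_coe])

theorem memLp_leftRegularFun (s : G) {f : G → ℂ} (hf : MemLp f 2 μ) :
    MemLp (σ.leftRegularFun s f) 2 μ := by
  have hs := measurePreserving_mul_left μ s⁻¹
  refine ⟨?_, by rw [eLpNorm_leftRegularFun σ μ s hf.1]; exact hf.2⟩
  exact (((σ.measurable_section s).comp hs.measurable).aestronglyMeasurable).mul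
    (hf.1.comp_measurePreserving hs)

theorem memLp_leftRegularInvFun (s : G) {f : G → ℂ} (hf : MemLp f 2 μ) :
    MemLp (σ.leftRegularInvFun s f) 2 μ := by
  have hs := measurePreserving_mul_left μ s
  have h := hf.comp_measurePreserving hs
  have hm : AEStronglyMeasurable (σ.leftRegularInvFun s f) μ :=
    ((Complex.continuous_conj.measurable.comp
      (σ.measurable_section s)).aestronglyMeasurable).mul h.1
  exact h.of_le hm (Filter.Eventually.of_forall fun t => by simp [leftRegularInvFun, Circle.norm_coe])

theorem leftRegularFun_congr (s : G) {f g : G → ℂ} (h : f =ᵐ[μ] g) :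
    σ.leftRegularFun s f =ᵐ[μ] σ.leftRegularFun s g := by
  have h' := (measurePreserving_mul_left μ s⁻¹).quasiMeasurePreserving.ae_eq_comp h
  filter_upwards [h'] with t ht
  simp only [Function.comp_apply] at ht
  simp [leftRegularFun, ht]

theorem leftRegularInvFun_congr (s : G) {f g : G → ℂ} (h : f =ᵐ[μ] g) :
    σ.leftRegularInvFun s f =ᵐ[μ] σ.leftRegularInvFun s g := by
  have h' := (measurePreserving_mul_left μ s).quasiMeasurePreserving.ae_eq_comp h
  filter_upwards [h'] with t ht
  simp only [Function.comp_apply] at ht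
  simp [leftRegularInvFun, ht]

/-- The left regular `σ`-representation on `L²(G) = L²(G,μ)`: for every `s` the unitary operator
`λ_σ(s)` with `(λ_σ(s) f)(t) = σ(s,s⁻¹t) f(s⁻¹t)` for almost every `t`. -/
noncomputable def leftRegular (s : G) : Lp ℂ 2 μ ≃ₗᵢ[ℂ] Lp ℂ 2 μ where
  toFun f := (σ.memLp_leftRegularFun μ s (Lp.memLp f)).toLp _
  invFun f := (σ.memLp_leftRegularInvFun μ s (Lp.memLp f)).toLp _
  map_add' f g := by
    rw [← MemLp.toLp_add]
    refine MemLp.toLp_congr _ _ ((σ.leftRegularFun_congr μ s (Lp.coeFn_add f g)).trans ?_)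
    exact Filter.Eventually.of_forall fun t => by simp [leftRegularFun, mul_add]
  map_smul' c f := by
    rw [RingHom.id_apply, ← MemLp.toLp_const_smul]
    refine MemLp.toLp_congr _ _ ((σ.leftRegularFun_congr μ s (Lp.coeFn_smul c f)).trans ?_)
    exact Filter.Eventually.of_forall fun t => by simp [leftRegularFun, mul_left_comm]
  left_inv f := by
    refine Lp.ext ((MemLp.coeFn_toLp _).trans
      ((σ.leftRegularInvFun_congr μ s (MemLp.coeFn_toLp _)).trans ?_))
    refine Filter.Eventually.of_forall fun t => ?_
    simp [leftRegularFun, leftRegularInvFun, ← mul_assoc, ← Complex.normSq_eq_conj_mul_self,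
      Complex.normSq_eq_norm_sq, Circle.norm_coe]
  right_inv f := by
    refine Lp.ext ((MemLp.coeFn_toLp _).trans
      ((σ.leftRegularFun_congr μ s (MemLp.coeFn_toLp _)).trans ?_))
    refine Filter.Eventually.of_forall fun t => ?_
    simp [leftRegularFun, leftRegularInvFun, ← mul_assoc, Complex.mul_conj,
      Complex.normSq_eq_norm_sq, Circle.norm_coe]
  norm_map' f := by
    change ‖(σ.memLp_leftRegularFun μ s (Lp.memLp f)).toLp _‖ = ‖f‖
    rw [Lp.norm_toLp, Lp.norm_def, eLpNorm_leftRegularFun σ μ s (Lp.memLp f).1]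

theorem leftRegular_coeFn (s : G) (f : Lp ℂ 2 μ) :
    σ.leftRegular μ s f =ᵐ[μ] fun t => (σ s (s⁻¹ * t) : ℂ) * f (s⁻¹ * t) :=
  MemLp.coeFn_toLp (σ.memLp_leftRegularFun μ s (Lp.memLp f))

end LeftRegular

end TwoCocycle

/-! Positive definiteness gives vectors `v s` in a Hilbert space `H` with Gram kernel `conj
σ(s,s⁻¹t) φ(s⁻¹t)` (`exists_inner_eq_kernel`), and formally φ(s) = ⟪v 1, v s⟫. Since φ has compact
support, Schur's test (`norm_integral_integral_le`) shows that f ↦ ∫ f(t) v(t) dt extends from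
C_c(G) to a bounded operator A : L²(G) → H. By the cocycle identity (`inner_translate`), A*A
commutes with λ_σ, hence so does S = (A*A)^{1/2}.

Let F run through bump functions concentrating at the identity. Then A F → v 1 and A λ_σ(s) F → v s.
Because ‖S f‖ = ‖A f‖, the vectors S F are Cauchy, even though F need not converge in L². Their
limit ψ satisfies ⟪ψ, λ_σ(s)ψ⟫ = lim ⟪A F, A λ_σ(s) F⟫ = φ(s) (`exists_inner_unitary_eq`). -/

/-! ### Positive semidefinite kernels -/

open scoped ComplexOrder in
/-- A complex kernel with nonnegative quadratic forms is Hermitian. -/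
theorem conj_kernel_of_nonneg {X : Type*} {k : X → X → ℂ}
    (hk : ∀ α : X →₀ ℂ, 0 ≤ ∑ s ∈ α.support, ∑ t ∈ α.support, k s t * conj (α s) * α t)
    (s t : X) : conj (k s t) = k t s := by
  classical
  have hsum (α : X →₀ ℂ) :
      (α.sum fun s a => α.sum fun t b => k s t * conj a * b).im = 0 :=
    (Complex.nonneg_iff.1 (hk α)).2.symm
  have key (a b : ℂ) : (k s s * conj a * a + k s t * conj a * b +
      (k t s * conj b * a + k t t * conj b * b)).im = 0 := by
    have h := hsum (Finsupp.single s a + Finsupp.single t b)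
    rw [Finsupp.sum_add_index' (by simp) (by
      intro x b₁ b₂; rw [← Finsupp.sum_add]; simp [mul_add, add_mul])] at h
    rw [Finsupp.sum_single_index (by simp), Finsupp.sum_single_index (by simp),
      Finsupp.sum_add_index' (by simp) (by intros; ring),
      Finsupp.sum_add_index' (by simp) (by intros; ring)] at h
    simpa using h
  -- The first two choices make the diagonal real, the third compares imaginary parts of `k s t` and
  -- `k t s`, and the fourth their real parts.
  have h1 := key 1 0
  have h2 := key 0 1
  have h3 := key 1 1
  have h4 := key 1 Complex.I
  simp at h1 h2 h3 h4
  apply Complex.ext <;> simp <;> linarith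

open scoped ComplexOrder in
/-- Kolmogorov decomposition of a positive semidefinite complex kernel. -/
theorem exists_inner_eq_kernel.{u} {X : Type u} {k : X → X → ℂ}
    (hk : ∀ α : X →₀ ℂ, 0 ≤ ∑ s ∈ α.support, ∑ t ∈ α.support, k s t * conj (α s) * α t) :
    ∃ (H : Type u) (_ : NormedAddCommGroup H) (_ : InnerProductSpace ℂ H)
      (_ : CompleteSpace H) (v : X → H), ∀ s t, inner ℂ (v s) (v t) = k s t := by
  let K : Matrix X X (ℂ →L[ℂ] ℂ) := .of fun s t => k s t • (1 : ℂ →L[ℂ] ℂ)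
  have hK : K.PosSemidef := by
    have h02 := (RKHS.posSemidef_tfae (K := K)).out 0 2
    refine h02.mpr ⟨?_, fun α => ?_⟩
    · ext s t
      simp [K, Matrix.conjTranspose_apply, conj_kernel_of_nonneg hk]
    · have h := (Complex.nonneg_iff.1 (hk α)).1
      rw [Finsupp.sum_comm]
      convert h using 1
      rw [← Complex.conj_re, ← RCLike.re_to_complex]
      congr 1
      simp only [Finsupp.sum, map_sum]
      refine Finset.sum_congr rfl fun s _ => Finset.sum_congr rfl fun t _ => ?_
      simp [K]
      ring
  have : Fact K.PosSemidef := ⟨hK⟩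
  refine ⟨RKHS.OfKernel K, inferInstance, inferInstance, inferInstance,
    fun s => RKHS.kerFun (RKHS.OfKernel K) s 1, fun s t => ?_⟩
  rw [← RKHS.kernel_inner, RKHS.OfKernel.kernel_ofKernel]
  simp [K, conj_kernel_of_nonneg hk]

/-- Vectors whose Gram function is continuous depend continuously on the parameter. -/
theorem continuous_of_continuous_inner {X H : Type*} [TopologicalSpace X]
    [NormedAddCommGroup H] [InnerProductSpace ℂ H] {v : X → H}
    (hv : Continuous fun p : X × X => inner ℂ (v p.1) (v p.2)) : Continuous v := by
  rw [continuous_iff_continuousAt]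
  intro x
  have h1 : Continuous fun t : X => inner ℂ (v t) (v t) :=
    hv.comp (continuous_id.prodMk continuous_id)
  have h2 : Continuous fun t : X => inner ℂ (v t) (v x) :=
    hv.comp (continuous_id.prodMk continuous_const)
  have h3 : Continuous fun t : X => inner ℂ (v x) (v t) :=
    hv.comp (continuous_const.prodMk continuous_id)
  -- Expanding ‖v t - v x‖² leaves only values of the Gram function.
  have h4 : Continuous fun t : X => Real.sqrt (inner ℂ (v t - v x) (v t - v x) : ℂ).re := by
    simp only [inner_sub_left, inner_sub_right]
    fun_prop
  rw [ContinuousAt, tendsto_iff_norm_sub_tendsto_zero]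
  have h5 := h4.tendsto x
  simp only [sub_self, inner_zero_left, Complex.zero_re, Real.sqrt_zero] at h5
  refine h5.congr fun t => ?_
  rw [← RCLike.re_to_complex, norm_eq_sqrt_re_inner (𝕜 := ℂ)]

/-! ### Matrix coefficients from an operator square root -/

open Filter Topology in
/-- If `A : E → H` has a Gram form that is invariant under unitaries `U i`, and `A ∘ U i` applied
to an approximating family converges to `v i`, then the Gram function of `v` against a base vector
is a matrix coefficient of `U`. -/
theorem exists_inner_unitary_eq {E H ι κ : Type*}
    [NormedAddCommGroup E] [InnerProductSpace ℂ E] [CompleteSpace E]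
    [NormedAddCommGroup H] [InnerProductSpace ℂ H] [CompleteSpace H]
    (A : E →L[ℂ] H) (U : ι → E ≃ₗᵢ[ℂ] E)
    (hU : ∀ i f g, inner ℂ (A (U i f)) (A (U i g)) = inner ℂ (A f) (A g))
    (l : Filter κ) [l.NeBot] (F : κ → E) (v₀ : H) (v : ι → H)
    (h₀ : Tendsto (fun n => A (F n)) l (𝓝 v₀))
    (hF : ∀ i, Tendsto (fun n => A (U i (F n))) l (𝓝 (v i))) :
    ∃ ψ : E, ∀ i, inner ℂ ψ (U i ψ) = inner ℂ v₀ (v i) := by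
  set T : E →L[ℂ] E := A.adjoint ∘L A with hT
  have hT0 : 0 ≤ T := by
    rw [ContinuousLinearMap.nonneg_iff_isPositive]
    exact ContinuousLinearMap.isPositive_adjoint_comp_self A
  set S : E →L[ℂ] E := CFC.sqrt T with hS
  have hSS : S * S = T := CFC.sqrt_mul_sqrt_self T hT0
  have hSs : ∀ f g, inner ℂ (S f) (S g) = inner ℂ (A f) (A g) := by
    intro f g
    have h0 : 0 ≤ S := CFC.sqrt_nonneg T
    have hsa : S.adjoint = S := by
      rw [ContinuousLinearMap.nonneg_iff_isPositive] at h0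
      exact h0.isSelfAdjoint.adjoint_eq
    rw [← ContinuousLinearMap.adjoint_inner_right, hsa, ← mul_apply_eq_comp, hSS, hT,
      ContinuousLinearMap.comp_apply, ContinuousLinearMap.adjoint_inner_right]
  have hcomm : ∀ i f, S (U i f) = U i (S f) := by
    intro i f
    let V : E →L[ℂ] E := (U i).toContinuousLinearEquiv
    have hTV : Commute T V := by
      ext g
      change T (U i g) = U i (T g)
      refine ext_inner_left ℂ fun w => ?_
      obtain ⟨w, rfl⟩ := (U i).surjective w
      rw [(U i).inner_map_map, hT, ContinuousLinearMap.comp_apply, ContinuousLinearMap.comp_apply,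
        ContinuousLinearMap.adjoint_inner_right, ContinuousLinearMap.adjoint_inner_right, hU]
    -- The square root arises from `T` by functional calculus, so it commutes with whatever commutes
    -- with `T`.
    have hSV : Commute S V := hTV.cfcₙ_nnreal _
    exact congrArg (fun B : E →L[ℂ] E => B f) hSV.eq
  have hnorm : ∀ f, ‖S f‖ = ‖A f‖ := fun f => by
    rw [norm_eq_sqrt_re_inner (𝕜 := ℂ), norm_eq_sqrt_re_inner (𝕜 := ℂ), hSs]
  have hC : Cauchy (map (fun n => S (F n)) l) := by
    have h := h₀.cauchy_map
    rw [Metric.cauchy_iff] at h ⊢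
    refine ⟨inferInstance, fun ε hε => ?_⟩
    obtain ⟨t, ht, hd⟩ := h.2 ε hε
    refine ⟨_, image_mem_map (mem_map.1 ht), ?_⟩
    rintro _ ⟨m, hm, rfl⟩ _ ⟨n, hn, rfl⟩
    have := hd _ hm _ hn
    rwa [dist_eq_norm, ← map_sub, ← hnorm, map_sub, ← dist_eq_norm] at this
  obtain ⟨ψ, hψ⟩ := CompleteSpace.complete hC
  have hψ : Tendsto (fun n => S (F n)) l (𝓝 ψ) := hψ
  refine ⟨ψ, fun i => ?_⟩
  have h1 := hψ.inner (𝕜 := ℂ) (((U i).continuous.tendsto ψ).comp hψ)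
  refine tendsto_nhds_unique h1 ?_
  refine (h₀.inner (𝕜 := ℂ) (hF i)).congr fun n => ?_
  simp only [Function.comp_apply]
  rw [← hcomm, hSs]

/-! ### Compactly supported functions in L² -/

open Set in
/-- In a locally compact regular space, compactly supported continuous functions are dense in
`Lᵖ` of a regular measure for `p < ∞`; no normality is required. -/
theorem exists_hasCompactSupport_eLpNorm_sub_le_of_regularSpace {X E : Type*} [TopologicalSpace X]
    [RegularSpace X] [LocallyCompactSpace X] [MeasurableSpace X] [BorelSpace X]
    [NormedAddCommGroup E] [NormedSpace ℝ E] {μ : Measure X} [μ.Regular] {p : ℝ≥0∞} (hp : p ≠ ∞)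
    {f : X → E} (hf : MemLp f p μ) {ε : ℝ≥0∞} (hε : ε ≠ 0) :
    ∃ g : X → E, eLpNorm (f - g) p μ ≤ ε ∧ Continuous g ∧ HasCompactSupport g := by
  suffices H : ∃ g : X → E, eLpNorm (f - g) p μ ≤ ε ∧
      Continuous g ∧ MemLp g p μ ∧ HasCompactSupport g by
    obtain ⟨g, h1, h2, -, h3⟩ := H
    exact ⟨g, h1, h2, h3⟩
  apply hf.induction_dense hp _ _ _ _ hε
  rotate_left
  · rintro f g ⟨f_cont, f_mem, hf⟩ ⟨g_cont, g_mem, hg⟩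
    exact ⟨f_cont.add g_cont, f_mem.add g_mem, hf.add hg⟩
  · rintro f ⟨_, f_mem, _⟩
    exact f_mem.aestronglyMeasurable
  intro c t ht htμ ε hε
  obtain ⟨δ, δpos, hδ⟩ := exists_Lp_half E μ p hε
  obtain ⟨η, ηpos, hη⟩ := exists_eLpNorm_indicator_le (μ := μ) hp c δpos.ne'
  have hη_pos' : (0 : ℝ≥0∞) < η := ENNReal.coe_pos.2 ηpos
  obtain ⟨s, st, s_compact, s_closed, μs⟩ :=
    ht.exists_isCompact_isClosed_sdiff_lt htμ.ne hη_pos'.ne'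
  have hsμ : μ s < ∞ := (measure_mono st).trans_lt htμ
  have I1 : eLpNorm ((s.indicator fun _ => c) - t.indicator fun _ => c) p μ ≤ δ := by
    rw [← eLpNorm_neg, neg_sub, ← indicator_sdiff st]
    exact hη _ μs.le
  obtain ⟨V, sV, V_open, -, hV⟩ := s_closed.measurableSet.exists_isOpen_sdiff_lt hsμ.ne hη_pos'.ne'
  -- Separating a compact set from a closed one is where local compactness and regularity replace
  -- normality.
  obtain ⟨g, hgs, hgV, g_supp, hg_range⟩ := exists_continuous_one_zero_of_isCompact s_compact
    V_open.isClosed_compl (disjoint_compl_right_iff_subset.2 sV)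
  have hgc_supp : HasCompactSupport fun x => g x • c := g_supp.smul_right
  have hgc : Continuous fun x => g x • c := by fun_prop
  have f_mem : MemLp (fun x => g x • c) p μ := hgc.memLp_of_hasCompactSupport hgc_supp
  have gc_bd : ∀ x, ‖g x • c - s.indicator (fun _ => c) x‖ ≤
      ‖(V \ s).indicator (fun _ => c) x‖ := by
    intro x
    by_cases hs : x ∈ s
    · simp [hgs hs, hs]
    by_cases hv : x ∈ V
    · simp only [hs, not_false_iff, indicator_of_notMem, sub_zero, hv, mem_sdiff, and_self,
        indicator_of_mem, norm_smul, Real.norm_eq_abs, abs_of_nonneg (hg_range x).1]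
      exact mul_le_of_le_one_left (norm_nonneg _) (hg_range x).2
    · simp [hgV hv, hs, hv]
  have I2 : eLpNorm ((fun x => g x • c) - s.indicator fun _ => c) p μ ≤ δ :=
    (eLpNorm_mono gc_bd).trans (hη _ hV.le)
  refine ⟨fun x => g x • c, ?_, hgc, f_mem, hgc_supp⟩
  convert! (hδ _ _
    (f_mem.aestronglyMeasurable.sub (aestronglyMeasurable_const.indicator s_closed.measurableSet))
    ((aestronglyMeasurable_const.indicator s_closed.measurableSet).sub
      (aestronglyMeasurable_const.indicator ht)) I2 I1).le using 2
  simp only [sub_add_sub_cancel]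

open CompactlySupported in
/-- The embedding of `C_c(X)` into `L²`. -/
noncomputable def compactlySupportedToL2 {X : Type*} [TopologicalSpace X] [MeasurableSpace X]
    [BorelSpace X] (μ : Measure X) [IsFiniteMeasureOnCompacts μ] : C_c(X, ℂ) →ₗ[ℂ] Lp ℂ 2 μ where
  toFun f := (f.continuous.memLp_of_hasCompactSupport f.hasCompactSupport).toLp f
  map_add' _ _ := rfl
  map_smul' _ _ := rfl

open CompactlySupported in
theorem denseRange_compactlySupportedToL2 {X : Type*} [TopologicalSpace X] [RegularSpace X]
    [LocallyCompactSpace X] [MeasurableSpace X] [BorelSpace X] (μ : Measure X) [μ.Regular] :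
    DenseRange (compactlySupportedToL2 μ) := by
  intro f
  rw [EMetric.mem_closure_iff]
  intro ε hε
  obtain ⟨δ, hδ, hδε⟩ := exists_between hε
  obtain ⟨g, h1, h2, h3⟩ := exists_hasCompactSupport_eLpNorm_sub_le_of_regularSpace
    (by simp) (Lp.memLp f) hδ.ne'
  refine ⟨_, ⟨⟨⟨g, h2⟩, h3⟩, rfl⟩, lt_of_le_of_lt ?_ hδε⟩
  refine le_trans (le_of_eq ?_) h1
  rw [← Lp.edist_toLp_toLp _ _ (Lp.memLp f) (h2.memLp_of_hasCompactSupport h3), Lp.toLp_coeFn]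
  rfl

open CompactlySupported in
theorem norm_compactlySupportedToL2_sq {X : Type*} [TopologicalSpace X] [MeasurableSpace X]
    [BorelSpace X] (μ : Measure X) [IsFiniteMeasureOnCompacts μ] (f : C_c(X, ℂ)) :
    ‖compactlySupportedToL2 μ f‖ ^ 2 = ∫ x, ‖f x‖ ^ 2 ∂μ := by
  have hf : MemLp f 2 μ := f.continuous.memLp_of_hasCompactSupport f.hasCompactSupport
  change ‖hf.toLp f‖ ^ 2 = _
  rw [Lp.norm_toLp, hf.eLpNorm_eq_integral_rpow_norm (by simp) (by simp), ENNReal.toReal_ofReal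
    (by positivity), ← Real.rpow_natCast, ← Real.rpow_mul (by positivity)]
  simp

/-! ### Bump functions and vector-valued integrals -/

open CompactlySupported in
/-- The nonnegative functions in `C_c(X)` with integral one and vanishing outside `U`. -/
def bumpsIn {X : Type*} [TopologicalSpace X] [MeasurableSpace X]
    (μ : Measure X) (U : Set X) : Set C_c(X, ℂ) :=
  {f | (∀ x, 0 ≤ (f x).re) ∧ (∀ x, (f x).im = 0) ∧ ∫ x, f x ∂μ = 1 ∧ ∀ x, f x ≠ 0 → x ∈ U}

theorem monotone_bumpsIn {X : Type*} [TopologicalSpace X] [MeasurableSpace X] {μ : Measure X} :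
    Monotone (bumpsIn μ) := fun _ _ h _ hf =>
  ⟨hf.1, hf.2.1, hf.2.2.1, fun x hx => h (hf.2.2.2 x hx)⟩

section VectorIntegral

open CompactlySupported

variable {X H : Type*} [TopologicalSpace X] [MeasurableSpace X] [BorelSpace X] {μ : Measure X}
  [IsFiniteMeasureOnCompacts μ] [NormedAddCommGroup H] [InnerProductSpace ℂ H]

theorem integrable_compactlySupported_smul (f : C_c(X, ℂ)) {v : X → H} (hv : Continuous v) :
    Integrable (fun x => f x • v x) μ :=
  (f.continuous.smul hv).integrable_of_hasCompactSupport f.hasCompactSupport.smul_right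

variable (μ) in
/-- The linear map `f ↦ ∫ f(x) v(x) dμ(x)` on `C_c(X)`. -/
noncomputable def integralSMul (v : X → H) (hv : Continuous v) : C_c(X, ℂ) →ₗ[ℂ] H where
  toFun f := ∫ x, f x • v x ∂μ
  map_add' f g := by
    simp only [CompactlySupportedContinuousMap.add_apply, add_smul]
    exact integral_add (integrable_compactlySupported_smul f hv)
      (integrable_compactlySupported_smul g hv)
  map_smul' c f := by
    simp only [CompactlySupportedContinuousMap.smul_apply, smul_eq_mul, mul_smul,
      RingHom.id_apply]
    exact integral_smul c _

theorem inner_integral_smul [CompleteSpace H] (f g : C_c(X, ℂ)) {v : X → H} (hv : Continuous v) :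
    inner ℂ (∫ x, f x • v x ∂μ) (∫ y, g y • v y ∂μ) =
      ∫ x, ∫ y, conj (f x) * g y * inner ℂ (v x) (v y) ∂μ ∂μ := by
  have h1 (w : H) : inner ℂ (∫ x, f x • v x ∂μ) w = ∫ x, inner ℂ (f x • v x) w ∂μ := by
    rw [← inner_conj_symm, ← integral_inner (integrable_compactlySupported_smul f hv),
      ← integral_conj]
    simp only [inner_conj_symm]
  rw [h1]
  congr 1 with x
  rw [← integral_inner (integrable_compactlySupported_smul g hv)]
  congr 1 with y
  rw [inner_smul_left, inner_smul_right]
  ring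

theorem norm_integral_smul_sub_le [CompleteSpace H] {f : C_c(X, ℂ)} (hf : ∀ x, 0 ≤ (f x).re)
    (hf' : ∀ x, (f x).im = 0) (hf1 : ∫ x, f x ∂μ = 1) {v : X → H} (hv : Continuous v) {w : H}
    {ε : ℝ} (hw : ∀ x, f x ≠ 0 → ‖v x - w‖ ≤ ε) :
    ‖∫ x, f x • v x ∂μ - w‖ ≤ ε := by
  have hfi : Integrable f μ := f.continuous.integrable_of_hasCompactSupport f.hasCompactSupport
  have h1 : ∫ x, f x • v x ∂μ - w = ∫ x, f x • (v x - w) ∂μ := by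
    simp only [smul_sub]
    rw [integral_sub (integrable_compactlySupported_smul f hv) (hfi.smul_const w),
      integral_smul_const, hf1, one_smul]
  have h2 : ∫ x, (f x).re * ε ∂μ = ε := by
    have := integral_re hfi
    simp only [RCLike.re_to_complex] at this
    rw [integral_mul_const, this, hf1]
    simp
  rw [h1, ← h2]
  refine norm_integral_le_of_norm_le (hfi.re.mul_const ε) (Filter.Eventually.of_forall fun x => ?_)
  have h3 : f x = ((f x).re : ℂ) := Complex.ext rfl (by simp [hf'])
  have h4 : ‖f x‖ = (f x).re := by
    rw [h3, Complex.norm_real, Real.norm_of_nonneg (hf x), Complex.ofReal_re]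
  rw [norm_smul, h4]
  by_cases h0 : f x = 0
  · simp [h0]
  · exact mul_le_mul_of_nonneg_left (hw x h0) (hf x)

-- Normalised Urysohn functions supply the bumps. A filter is used instead of a sequence because the
-- space need not be first countable.
open Filter Topology in
theorem lift_bumpsIn_neBot [μ.IsOpenPosMeasure] [RegularSpace X] [LocallyCompactSpace X] (x : X) :
    ((𝓝 x).lift' (bumpsIn μ)).NeBot := by
  rw [lift'_neBot_iff monotone_bumpsIn]
  intro U hU
  obtain ⟨g, hg1, hgU, g_supp, hg_range⟩ := exists_continuous_one_zero_of_isCompact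
    (isCompact_singleton (x := x)) (isOpen_interior (s := U)).isClosed_compl
    (by simpa using mem_interior_iff_mem_nhds.2 hU)
  have hgx : g x = 1 := hg1 rfl
  have hpos : 0 < ∫ y, g y ∂μ := g.continuous.integral_pos_of_hasCompactSupport_nonneg_nonzero
    g_supp (fun y => (hg_range y).1) (x := x) (by simp [hgx])
  set I := ∫ y, g y ∂μ with hI
  let f : C_c(X, ℂ) := ⟨⟨fun y => ((I⁻¹ * g y : ℝ) : ℂ), by fun_prop⟩,
    (g_supp.mul_left (f := fun _ => I⁻¹)).comp_left Complex.ofReal_zero⟩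
  have hf (y : X) : f y = ((I⁻¹ * g y : ℝ) : ℂ) := rfl
  refine ⟨f, fun y => ?_, fun y => ?_, ?_, fun y hy => ?_⟩
  · rw [hf, Complex.ofReal_re]
    exact mul_nonneg (inv_nonneg.2 hpos.le) (hg_range y).1
  · rw [hf, Complex.ofReal_im]
  · simp only [hf]
    rw [integral_complex_ofReal, integral_const_mul, ← hI, inv_mul_cancel₀ hpos.ne', Complex.ofReal_one]
  · by_contra h
    exact hy (by simp [hf, hgU (show y ∈ (interior U)ᶜ from fun h' => h (interior_subset h'))])

open Filter Topology in
theorem tendsto_integral_smul_lift_bumpsIn [CompleteSpace H] (x : X) {v : X → H}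
    (hv : Continuous v) :
    Tendsto (fun f : C_c(X, ℂ) => ∫ y, f y • v y ∂μ) ((𝓝 x).lift' (bumpsIn μ)) (𝓝 (v x)) := by
  rw [Metric.tendsto_nhds]
  intro ε hε
  have hU : {y | ‖v y - v x‖ < ε / 2} ∈ 𝓝 x := by
    have h : ∀ᶠ y in 𝓝 x, ‖v y - v x‖ < ε / 2 := by
      simpa only [dist_eq_norm] using Metric.tendsto_nhds.1 (hv.tendsto x) (ε / 2) (half_pos hε)
    exact h
  filter_upwards [mem_lift' hU] with f hf
  rw [dist_eq_norm]
  exact (norm_integral_smul_sub_le hf.1 hf.2.1 hf.2.2.1 hv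
    fun y hy => (hf.2.2.2 y hy).le).trans_lt (half_lt_self hε)

end VectorIntegral

/-! ### Schur's test on a group -/

theorem hasCompactSupport_mul_comp_inv_mul {G : Type*} [Group G] [TopologicalSpace G]
    [IsTopologicalGroup G] [T2Space G] {a q : G → ℝ} (ha : HasCompactSupport a)
    (hq : HasCompactSupport q) :
    HasCompactSupport (Function.uncurry fun s t : G => a t * q (s⁻¹ * t)) := by
  refine HasCompactSupport.intro ((ha.isCompact.prod hq.isCompact).image
    (f := fun p : G × G => (p.1 * p.2⁻¹, p.1)) (by fun_prop)) ?_
  rintro ⟨s, t⟩ hst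
  by_contra h
  obtain ⟨h1, h2⟩ := mul_ne_zero_iff.1 h
  exact hst ⟨(t, s⁻¹ * t), ⟨subset_tsupport _ h1, subset_tsupport _ h2⟩, by simp⟩

section ConvolutionBound

open CompactlySupported

variable {G : Type*} [Group G] [TopologicalSpace G] [IsTopologicalGroup G] [T2Space G]
  [MeasurableSpace G] [BorelSpace G] {μ : Measure G} [IsFiniteMeasureOnCompacts μ]

theorem integrable_integral_mul_comp_inv_mul {a q : G → ℝ} (ha : Continuous a)
    (ha' : HasCompactSupport a) (hq : Continuous q) (hq' : HasCompactSupport q) :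
    Integrable (fun s => ∫ t, a t * q (s⁻¹ * t) ∂μ) μ := by
  refine Continuous.integrable_of_hasCompactSupport ?_ ?_
  · rw [← continuousOn_univ]
    refine continuousOn_integral_of_compact_support ha'.isCompact (by fun_prop) ?_
    intro s t _ ht
    rw [image_eq_zero_of_notMem_tsupport ht, zero_mul]
  · refine HasCompactSupport.intro
      ((hasCompactSupport_mul_comp_inv_mul ha' hq').isCompact.image continuous_fst) ?_
    intro s hs
    refine integral_eq_zero_of_ae (Filter.Eventually.of_forall fun t => ?_)
    by_contra h
    exact hs ⟨(s, t), subset_tsupport _ h, rfl⟩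

/-- Schur's test for a kernel dominated by `q(s⁻¹t)`, with `q` continuous and compactly
supported. -/
theorem norm_integral_integral_le [μ.IsMulLeftInvariant] {q : G → ℝ} (hq : Continuous q)
    (hq' : HasCompactSupport q) {k : G → G → ℂ} (hk : ∀ s t, ‖k s t‖ ≤ q (s⁻¹ * t))
    (f : C_c(G, ℂ)) :
    ‖∫ s, ∫ t, conj (f s) * f t * k s t ∂μ ∂μ‖ ≤
      ((∫ s, q s ∂μ + ∫ s, q s⁻¹ ∂μ) / 2) * ∫ s, ‖f s‖ ^ 2 ∂μ := by
  set a : G → ℝ := fun s => ‖f s‖ ^ 2 with ha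
  have hac : Continuous a := by fun_prop
  have has : HasCompactSupport a := f.hasCompactSupport.comp_left (g := fun z => ‖z‖ ^ 2) (by simp)
  have hai : Integrable a μ := hac.integrable_of_hasCompactSupport has
  have hqs (s : G) : Integrable (fun t => q (s⁻¹ * t)) μ :=
    (hq.integrable_of_hasCompactSupport hq').comp_mul_left s⁻¹
  have haq (s : G) : Integrable (fun t => a t * q (s⁻¹ * t)) μ :=
    Continuous.integrable_of_hasCompactSupport (by fun_prop) has.mul_right
  have hJ := integrable_integral_mul_comp_inv_mul (μ := μ) hac has hq hq'
  -- Compact support allows the swap without σ-finiteness. The inversion in `q s⁻¹` remains because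
  -- the group need not be unimodular.
  have hswap : ∫ s, ∫ t, a t * q (s⁻¹ * t) ∂μ ∂μ = (∫ s, a s ∂μ) * ∫ s, q s⁻¹ ∂μ := by
    rw [integral_integral_swap_of_hasCompactSupport (by fun_prop)
      (hasCompactSupport_mul_comp_inv_mul has hq'), ← integral_mul_const]
    congr 1 with t
    rw [integral_const_mul, ← integral_mul_left_eq_self (fun s => q s⁻¹) t⁻¹]
    simp
  have hbound (s : G) : ‖∫ t, conj (f s) * f t * k s t ∂μ‖ ≤
      (a s * ∫ t, q t ∂μ + ∫ t, a t * q (s⁻¹ * t) ∂μ) / 2 := by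
    rw [← integral_mul_left_eq_self q s⁻¹, ← integral_const_mul,
      ← integral_add ((hqs s).const_mul _) (haq s), ← integral_div]
    refine norm_integral_le_of_norm_le ((((hqs s).const_mul _).add (haq s)).div_const 2)
      (Filter.Eventually.of_forall fun t => ?_)
    have hq0 : 0 ≤ q (s⁻¹ * t) := (norm_nonneg _).trans (hk s t)
    calc ‖conj (f s) * f t * k s t‖ = ‖f s‖ * ‖f t‖ * ‖k s t‖ := by simp
      _ ≤ ‖f s‖ * ‖f t‖ * q (s⁻¹ * t) := by gcongr; exact hk s t
      _ ≤ ((‖f s‖ ^ 2 + ‖f t‖ ^ 2) / 2) * q (s⁻¹ * t) := by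
        gcongr; linarith [two_mul_le_add_sq ‖f s‖ ‖f t‖]
      _ = _ := by simp only [ha]; ring
  calc _ ≤ ∫ s, (a s * ∫ t, q t ∂μ + ∫ t, a t * q (s⁻¹ * t) ∂μ) / 2 ∂μ :=
        norm_integral_le_of_norm_le (((hai.mul_const _).add hJ).div_const 2)
          (Filter.Eventually.of_forall hbound)
    _ = _ := by
      rw [integral_div, integral_add (hai.mul_const _) hJ, hswap, integral_mul_const]
      ring

end ConvolutionBound

/-! ### Twisted translation -/

namespace TwoCocycle

open CompactlySupported

variable {G : Type*} [Group G] [TopologicalSpace G] (σ : TwoCocycle G)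

variable {σ} in
theorem IsContinuous.comp {X : Type*} [TopologicalSpace X] (hσ : σ.IsContinuous) {f g : X → G}
    (hf : Continuous f) (hg : Continuous g) : Continuous fun x => (σ (f x) (g x) : ℂ) :=
  continuous_subtype_val.comp (Continuous.comp hσ (hf.prodMk hg))

theorem conj_mul_self_coe (s t : G) : conj (σ s t : ℂ) * σ s t = 1 := by
  rw [← Circle.coe_inv_eq_conj, ← Circle.coe_mul, inv_mul_cancel, Circle.coe_one]

/-- The action of `λ_σ(s)` on `C_c(G)`. -/
noncomputable def translateCc [IsTopologicalGroup G] (hσ : σ.IsContinuous) (r : G) (f : C_c(G, ℂ)) :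
    C_c(G, ℂ) where
  toFun t := (σ r (r⁻¹ * t) : ℂ) * f (r⁻¹ * t)
  continuous_toFun := (hσ.comp continuous_const (by fun_prop)).mul (by fun_prop)
  hasCompactSupport' :=
    (f.hasCompactSupport.comp_homeomorph (Homeomorph.mulLeft r⁻¹)).mul_left

theorem leftRegular_compactlySupportedToL2 [IsTopologicalGroup G] [MeasurableSpace G]
    [BorelSpace G] (μ : Measure G) [μ.IsMulLeftInvariant] [IsFiniteMeasureOnCompacts μ]
    (hσ : σ.IsContinuous) (r : G) (f : C_c(G, ℂ)) :
    σ.leftRegular μ r (compactlySupportedToL2 μ f) =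
      compactlySupportedToL2 μ (σ.translateCc hσ r f) :=
  MemLp.toLp_congr (σ.memLp_leftRegularFun μ r (Lp.memLp _))
    ((σ.translateCc hσ r f).continuous.memLp_of_hasCompactSupport
      (σ.translateCc hσ r f).hasCompactSupport)
    (σ.leftRegularFun_congr μ r
      (MemLp.coeFn_toLp (f.continuous.memLp_of_hasCompactSupport f.hasCompactSupport)))

/-- Substituting t ↦ rt moves the translation from `f` onto the vectors; the new field takes the
value `v r` at the identity. -/
theorem integral_translateCc_smul [IsTopologicalGroup G] [MeasurableSpace G] [BorelSpace G]
    (μ : Measure G) [μ.IsMulLeftInvariant] {H : Type*} [NormedAddCommGroup H]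
    [InnerProductSpace ℂ H] (hσ : σ.IsContinuous) (r : G) (f : C_c(G, ℂ)) (v : G → H) :
    ∫ t, σ.translateCc hσ r f t • v t ∂μ = ∫ t, f t • ((σ r t : ℂ) • v (r * t)) ∂μ := by
  rw [← integral_mul_left_eq_self _ r]
  congr 1 with t
  change ((σ r (r⁻¹ * (r * t)) : ℂ) * f (r⁻¹ * (r * t))) • v (r * t) = _
  rw [inv_mul_cancel_left, smul_smul, mul_comm]

/-- The kernel `conj σ(s,s⁻¹t) φ(s⁻¹t)` changes by a coboundary under left translation. -/
theorem inner_translate {H : Type*} [NormedAddCommGroup H] [InnerProductSpace ℂ H] {φ : G → ℂ}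
    {v : G → H} (hv : ∀ s t, inner ℂ (v s) (v t) = conj (σ s (s⁻¹ * t) : ℂ) * φ (s⁻¹ * t))
    (r s t : G) :
    inner ℂ ((σ r s : ℂ) • v (r * s)) ((σ r t : ℂ) • v (r * t)) = inner ℂ (v s) (v t) := by
  have h : (r * s)⁻¹ * (r * t) = s⁻¹ * t := by group
  -- The cocycle identity at (r, s, s⁻¹t): the scalars `σ r s` and `σ r t` absorb the coboundary.
  have hc : (σ r s : ℂ) * σ (r * s) (s⁻¹ * t) = σ r t * σ s (s⁻¹ * t) := by
    have := σ.cocycle r s (s⁻¹ * t)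
    rw [mul_inv_cancel_left] at this
    exact_mod_cast congrArg (Circle.coeHom) this
  have hc' := congrArg conj hc
  rw [map_mul, map_mul] at hc'
  rw [inner_smul_left, inner_smul_right, hv, hv, h]
  linear_combination (σ r t * φ (s⁻¹ * t)) * hc' +
    (conj (σ s (s⁻¹ * t) : ℂ) * φ (s⁻¹ * t)) * σ.conj_mul_self_coe r t

end TwoCocycle

/-! ### The square-integrable vector -/

theorem mainTheorem7 {G : Type*} [Group G] [TopologicalSpace G] [IsTopologicalGroup G]
    [LocallyCompactSpace G] [T2Space G] [MeasurableSpace G] [BorelSpace G]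
    (μ : Measure G) [μ.IsHaarMeasure] [μ.Regular]
    (σ : TwoCocycle G) (hσ : σ.IsContinuous)
    (φ : G → ℂ) (hφ : φ ∈ σ.P₁) (hφc : HasCompactSupport φ) :
    ∃ ψ : Lp ℂ 2 μ, ∀ s : G, φ s = inner ℂ ψ (σ.leftRegular μ s ψ) := by
  obtain ⟨⟨hφcont, -, hφpos⟩, -⟩ := hφ
  obtain ⟨H, _, _, _, v, hv⟩ := exists_inner_eq_kernel hφpos
  have hvc : Continuous v := by
    refine continuous_of_continuous_inner ?_
    simp only [hv]
    exact (Complex.continuous_conj.comp (hσ.comp (by fun_prop) (by fun_prop))).mul (by fun_prop)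
  have hwc (r : G) : Continuous fun t => (σ r t : ℂ) • v (r * t) :=
    (hσ.comp continuous_const continuous_id).smul (by fun_prop)
  have hqc : HasCompactSupport fun s => ‖φ s‖ := hφc.norm
  set e := compactlySupportedToL2 μ with he
  have hdense : DenseRange e := denseRange_compactlySupportedToL2 μ
  set a := integralSMul μ v hvc with ha
  -- The Gram kernel has modulus |φ(s⁻¹t)|, so Schur's test applies with q = |φ|; compact support of
  -- φ makes the constant finite.
  have hbound : ∃ C, ∀ f, ‖a f‖ ≤ C * ‖e f‖ := by
    set C := (∫ s, ‖φ s‖ ∂μ + ∫ s, ‖φ s⁻¹‖ ∂μ) / 2 with hC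
    refine ⟨√C, fun f => ?_⟩
    rw [← Real.sqrt_sq (norm_nonneg (a f)), ← Real.sqrt_sq (norm_nonneg (e f)),
      ← Real.sqrt_mul (by positivity)]
    refine Real.sqrt_le_sqrt ?_
    have h1 := norm_integral_integral_le (μ := μ) hφcont.norm hqc
      (k := fun s t => inner ℂ (v s) (v t)) (fun s t => by simp [hv, Circle.norm_coe]) f
    rw [← inner_integral_smul f f hvc, inner_self_eq_norm_sq_to_K] at h1
    rw [he, norm_compactlySupportedToL2_sq]
    refine le_trans (le_of_eq ?_) h1
    simp [ha, integralSMul]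
  have hext := LinearMap.extendOfNorm_eq hdense hbound
  set A := a.extendOfNorm e with hA
  have hAU (r : G) (f : CompactlySupportedContinuousMap G ℂ) :
      A (σ.leftRegular μ r (e f)) = ∫ t, f t • ((σ r t : ℂ) • v (r * t)) ∂μ := by
    rw [he, σ.leftRegular_compactlySupportedToL2 μ hσ, ← he, hext]
    exact σ.integral_translateCc_smul μ hσ r f v
  have hU (r : G) (f g : Lp ℂ 2 μ) : inner ℂ (A (σ.leftRegular μ r f))
      (A (σ.leftRegular μ r g)) = inner ℂ (A f) (A g) := by
    induction f, g using hdense.induction_on₂ with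
    | hp => exact isClosed_eq (by fun_prop) (by fun_prop)
    | h f g =>
      rw [hAU, hAU, hext, hext, inner_integral_smul f g (hwc r)]
      simp only [σ.inner_translate hv]
      exact (inner_integral_smul f g hvc).symm
  have := lift_bumpsIn_neBot (μ := μ) (1 : G)
  obtain ⟨ψ, hψ⟩ := exists_inner_unitary_eq A (σ.leftRegular μ) hU
    ((nhds (1 : G)).lift' (bumpsIn μ)) e (v 1) v
    (by simp only [hext]; exact tendsto_integral_smul_lift_bumpsIn (μ := μ) 1 hvc)
    (fun r => by
      simpa only [hAU, σ.right_one, Circle.coe_one, one_smul, mul_one]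
        using tendsto_integral_smul_lift_bumpsIn (μ := μ) 1 (hwc r))
  refine ⟨ψ, fun s => ?_⟩
  -- What remains is `conj σ(1,s) φ(s)`, and the cocycle is normalised.
  rw [hψ, hv]
  simp [σ.left_one]
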